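/- Let $a,b\ge 0$ and let $\bar\nu$ be a measure on $(0,\infty)$ with $\int_0^\infty (z\wedge 1)\,\bar\nu(dz)<\infty$. Let $$f(x)=a+bx+\int_0^\infty (1-e^{-sx})\,\bar\nu(ds),\quad x>0,\qquad \nu(s)=a+\bar\nu(s,\infty),\quad s>0.$$ Let ${}^f\sigma(t)$, $t\ge 0$, be the (possibly killed) subordinator with Laplace exponent $f$: a $[0,\infty]$-valued process with ${}^f\sigma(0)=0$ and non-decreasing paths, such that for all $s,h\ge0$, conditionally on $\{{}^f\sigma(s)<\infty\}$, the increment ${}^f\sigma(s+h)-{}^f\sigma(s)$ is independent of $({}^f\sigma(u))_{u\le s}$ and has the law of ${}^f\sigma(h)$, and such that $\mathbb{E}\,e^{-\lambda\,{}^f\sigma(t)}=e^{-tf(\lambda)}$ for all $\lambda>0$, $t\ge0$ (with $e^{-\infty}=0$). Let $${}^fL(t)=\inf\{s>0:\ {}^f\sigma(s)>t\}\in[0,\infty],\qquad t\ge0\qquad(\inf\emptyset=\infty)$$ be its inverse. Let $N(t)$, $t\ge0$, be a homogeneous Poisson process of rate $1$ (with non-decreasing paths) and, for each $\gamma>0$,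 let $Y_1^{\gamma},Y_2^{\gamma},\dots$ be i.i.d. $[0,\infty]$-valued random variables, independent of $N$, with law $$\Pr\{Y_j^{\gamma}\in dy\}=\frac{1}{\nu(\gamma)}\bigl(\bar\nu(dy)+a\,\delta_\infty(dy)\bigr)\mathbf 1_{\{y>\gamma\}}$$ whenever $\nu(\gamma)>0$ (if $\nu(\gamma)=0$ their law is irrelevant, because then $N(t\,\nu(\gamma))=N(0)=0$ almost surely and the sum below is empty). Put $$X_\gamma(t)=bt+\sum_{j=1}^{N(t\,\nu(\gamma))}Y_j^{\gamma},\qquad t\ge 0.$$ Then, for every fixed $t\ge0$, the following convergences in distribution of $[0,\infty]$-valued random variables hold as $\gamma\downarrow 0$: 1. $X_\gamma(t)\ \longrightarrow\ {}^f\sigma(t)$; 2. $\inf\{s>0:\ X_\gamma(s)>t\}\ \longrightarrow\ {}^fL(t)$. -/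

import Mathlib

open MeasureTheory ProbabilityTheory Filter Topology Set
open scoped NNReal ENNReal

namespace SubordinatorCTRW

/-- A Lévy triplet `(a, b, ν̄)`: killing rate `a ≥ 0`, drift `b ≥ 0`, and a measure `ν̄` on
`(0, ∞)` with `∫ (z ∧ 1) ν̄(dz) < ∞`. -/
structure LevyTriplet where
  a : ℝ≥0
  b : ℝ≥0
  levy : Measure ℝ
  levy_Iic_zero : levy (Iic 0) = 0
  lintegral_min_lt_top : ∫⁻ z, ENNReal.ofReal (min z 1) ∂levy < ∞

namespace LevyTriplet

/-- The Bernstein function `f(x) = a + b x + ∫ (1 - e^{-s x}) ν̄(ds)`, for `x > 0`. -/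
noncomputable def bernstein (T : LevyTriplet) (x : ℝ) : ℝ :=
  T.a + T.b * x + ∫ s, (1 - Real.exp (-(s * x))) ∂T.levy

/-- The tail `ν(s) = a + ν̄(s, ∞)`, which is finite for `s > 0`. -/
noncomputable def tail (T : LevyTriplet) (s : ℝ) : ℝ≥0 :=
  T.a + (T.levy (Ioi s)).toNNReal

/-- The jump law `(ν̄(dy) + a δ_∞) 1_{y > γ} / ν(γ)` on `[0, ∞]`, for `γ > 0` with
`ν(γ) ≠ 0`. -/
noncomputable def jumpLaw (T : LevyTriplet) (γ : ℝ) : Measure ℝ≥0∞ :=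
  (T.tail γ)⁻¹ • ((T.levy.restrict (Ioi γ)).map ENNReal.ofReal + T.a • Measure.dirac ∞)

end LevyTriplet

/-- `e^{-l x}` for `l > 0` and `x ∈ [0, ∞]`, with `e^{-∞} = 0`. -/
noncomputable def expNegMul (l : ℝ) (x : ℝ≥0∞) : ℝ :=
  if x = ∞ then 0 else Real.exp (-(l * x.toReal))

/-- A homogeneous Poisson process of rate `r`: it starts at `0`, has non-decreasing paths and
independent increments, and `N (s + h) - N s` is Poisson with mean `r * h`.
Right-continuity of the paths is not required, so that every version with non-decreasing paths
is covered. -/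
structure IsPoissonProcess {Ω : Type*} [MeasurableSpace Ω] (r : ℝ≥0) (N : ℝ≥0 → Ω → ℕ)
    (P : Measure Ω) : Prop where
  measurable : ∀ t, Measurable (N t)
  zero : ∀ᵐ ω ∂P, N 0 ω = 0
  mono : ∀ᵐ ω ∂P, Monotone fun t ↦ N t ω
  indep : HasIndepIncrements N P
  law : ∀ s h : ℝ≥0, HasLaw (fun ω ↦ N (s + h) ω - N s ω) (poissonMeasure (r * h)) P

/-- The (possibly killed) subordinator with Laplace exponent the Bernstein function of `T`: a
`[0, ∞]`-valued process starting at `0` with non-decreasing paths (so that `∞` is absorbing),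
with independent and homogeneous increments on `[0, ζ)`, where `ζ` is the lifetime: given
`σ s < ∞`, the increment `σ (s + h) - σ s` is independent of the past up to time `s` and has the
law of `σ h`; and `E e^{-l σ(t)} = e^{-t f(l)}` for `l > 0`.
Right-continuity of the paths is not required, so that every version with non-decreasing paths
is covered. -/
structure IsSubordinator {Ω : Type*} [MeasurableSpace Ω] (T : LevyTriplet)
    (σ : ℝ≥0 → Ω → ℝ≥0∞) (P : Measure Ω) : Prop where
  measurable : ∀ t, Measurable (σ t)
  zero : ∀ᵐ ω ∂P, σ 0 ω = 0
  mono : ∀ᵐ ω ∂P, Monotone fun t ↦ σ t ω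
  increments : ∀ (s h : ℝ≥0) (A : Set Ω) (B : Set ℝ≥0∞),
    MeasurableSet[⨆ u : Iic s, MeasurableSpace.comap (σ u) inferInstance] A →
    MeasurableSet B →
    P (A ∩ {ω | σ s ω < ∞} ∩ {ω | σ (s + h) ω - σ s ω ∈ B}) =
      P (A ∩ {ω | σ s ω < ∞}) * P {ω | σ h ω ∈ B}
  laplace : ∀ (t : ℝ≥0) (l : ℝ), 0 < l →
    ∫ ω, expNegMul l (σ t ω) ∂P = Real.exp (-(t * T.bernstein l))

/-- The hitting time `inf {s > 0 : X s > t}` of a path `X`, an element of `[0, ∞]`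
(`inf ∅ = ∞`). -/
noncomputable def hittingTime (X : ℝ≥0 → ℝ≥0∞) (t : ℝ≥0) : ℝ≥0∞ :=
  ⨅ (s : ℝ≥0) (_ : 0 < s ∧ (t : ℝ≥0∞) < X s), (s : ℝ≥0∞)

/-- The random walk `b t + ∑_{j ≤ N(t θ)} Y_j`, whose sum has exactly `N(t θ)` terms; the i.i.d.
jumps are numbered from `0`. -/
noncomputable def ctrw {Ω : Type*} (b θ : ℝ≥0) (N : ℝ≥0 → Ω → ℕ) (Y : ℕ → Ω → ℝ≥0∞)
    (t : ℝ≥0) (ω : Ω) : ℝ≥0∞ :=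
  (b : ℝ≥0∞) * t + ∑ j ∈ Finset.range (N (t * θ) ω), Y j ω

end SubordinatorCTRW

namespace SubordinatorCTRW

/-! By Stone–Weierstrass, polynomials in `e^{-x}` are dense in the continuous functions on the
compact space `[0, ∞]`, so convergence of Laplace transforms gives weak convergence
(`tendsto_of_tendsto_laplace`). The Laplace exponent of the random walk is `f` with the Lévy measure
cut off below `γ` (`integral_expNegMul_ctrw`), and it tends to `f` by dominated convergence. This
proves the first claim.

For the second, the Laplace transform of a hitting time is an integral of probabilities `P(X_u > t)`
over `u` (`integral_expNegMul_hittingTime`), so it suffices that these converge for every `u`. Weak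
convergence alone does not give this at atoms of the limit. It does here because the walk grows
stochastically as `γ` decreases: erasing the jumps of size at most `γ` from the walk of level `γ' ≤
γ` gives the law of the walk of level `γ` (`measure_ctrw_le_mono`,
`tendsto_measure_le_of_stochasticallyMonotone`). -/

@[simp]
lemma expNegMul_top (l : ℝ) : expNegMul l ∞ = 0 := by simp [expNegMul]

@[simp]
lemma expNegMul_zero (l : ℝ) : expNegMul l 0 = 1 := by simp [expNegMul]

lemma expNegMul_of_ne_top (l : ℝ) {x : ℝ≥0∞} (hx : x ≠ ∞) :
    expNegMul l x = Real.exp (-(l * x.toReal)) := by simp [expNegMul, hx]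

lemma expNegMul_ofReal (l : ℝ) {x : ℝ} (hx : 0 ≤ x) :
    expNegMul l (ENNReal.ofReal x) = Real.exp (-(l * x)) := by
  rw [expNegMul_of_ne_top l ENNReal.ofReal_ne_top, ENNReal.toReal_ofReal hx]

lemma expNegMul_nonneg (l : ℝ) (x : ℝ≥0∞) : 0 ≤ expNegMul l x := by
  unfold expNegMul; split_ifs <;> positivity

lemma expNegMul_le_one {l : ℝ} (hl : 0 < l) (x : ℝ≥0∞) : expNegMul l x ≤ 1 := by
  unfold expNegMul
  split_ifs
  · exact zero_le_one
  · have := mul_nonneg hl.le (ENNReal.toReal_nonneg (a := x))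
    exact Real.exp_le_one_iff.2 (by linarith)

lemma expNegMul_add (l : ℝ) (x y : ℝ≥0∞) :
    expNegMul l (x + y) = expNegMul l x * expNegMul l y := by
  by_cases hx : x = ∞
  · simp [hx]
  by_cases hy : y = ∞
  · simp [hy]
  rw [expNegMul_of_ne_top l hx, expNegMul_of_ne_top l hy,
    expNegMul_of_ne_top l (ENNReal.add_ne_top.2 ⟨hx, hy⟩), ENNReal.toReal_add hx hy, ← Real.exp_add]
  ring_nf

lemma expNegMul_sum (l : ℝ) (n : ℕ) (y : ℕ → ℝ≥0∞) :
    expNegMul l (∑ j ∈ Finset.range n, y j) = ∏ j ∈ Finset.range n, expNegMul l (y j) := by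
  induction n with
  | zero => simp
  | succ n ih => rw [Finset.sum_range_succ, Finset.prod_range_succ, expNegMul_add, ih]

lemma expNegMul_natCast_mul (n : ℕ) (l : ℝ) (hn : n ≠ 0) (x : ℝ≥0∞) :
    expNegMul (n * l) x = expNegMul l x ^ n := by
  unfold expNegMul
  split_ifs
  · simp [hn]
  · rw [← Real.exp_nat_mul]
    ring_nf

lemma lt_expNegMul_iff {l s : ℝ} (hl : 0 < l) (hs : 0 < s) (x : ℝ≥0∞) :
    s < expNegMul l x ↔ x < ENNReal.ofReal (-Real.log s / l) := by
  by_cases hx : x = ∞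
  · simp [hx, hs.le]
  rw [expNegMul_of_ne_top l hx, ENNReal.lt_ofReal_iff_toReal_lt hx, lt_div_iff₀ hl,
    ← Real.log_lt_iff_lt_exp hs]
  constructor <;> intro h <;> linarith

/-- Unlike the strict version, this needs `s ≤ 1`: for `s > 1` the right-hand bound truncates to `0`
and `x = 0` would be a counterexample. -/
lemma le_expNegMul_iff {l s : ℝ} (hl : 0 < l) (hs : 0 < s) (hs1 : s ≤ 1) (x : ℝ≥0∞) :
    s ≤ expNegMul l x ↔ x ≤ ENNReal.ofReal (-Real.log s / l) := by
  by_cases hx : x = ∞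
  · simp [hx, hs]
  have := Real.log_nonpos hs.le hs1
  rw [expNegMul_of_ne_top l hx, ENNReal.le_ofReal_iff_toReal_le hx (div_nonneg (neg_nonneg.2 this) hl.le),
    le_div_iff₀ hl, ← Real.log_le_iff_le_exp hs]
  constructor <;> intro h <;> linarith

lemma continuous_expNegMul {l : ℝ} (hl : 0 < l) : Continuous (expNegMul l) := by
  rw [continuous_iff_continuousAt]
  intro x
  by_cases hx : x = ∞
  · subst hx
    rw [ContinuousAt, expNegMul_top, tendsto_order]
    refine ⟨fun a ha ↦ .of_forall fun y ↦ ha.trans_le (expNegMul_nonneg l y), fun a ha ↦ ?_⟩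
    have h0 : 0 < a / 2 := by positivity
    filter_upwards [lt_mem_nhds (ENNReal.ofReal_lt_top (r := -Real.log (a / 2) / l))] with y hy
    have := mt (lt_expNegMul_iff hl h0 y).1 hy.not_gt
    linarith [not_lt.1 this]
  · have h : (fun y : ℝ≥0∞ ↦ Real.exp (-(l * y.toReal))) =ᶠ[𝓝 x] expNegMul l := by
      filter_upwards [isOpen_ne.mem_nhds hx] with y hy using (expNegMul_of_ne_top l hy).symm
    refine ContinuousAt.congr ?_ h
    have := ENNReal.continuousAt_toReal hx
    fun_prop

lemma measurable_expNegMul {l : ℝ} (hl : 0 < l) : Measurable (expNegMul l) :=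
  (continuous_expNegMul hl).measurable

lemma expNegMul_one_injective : Function.Injective (expNegMul 1) := by
  intro x y h
  by_cases hx : x = ∞ <;> by_cases hy : y = ∞
  · rw [hx, hy]
  · rw [hx, expNegMul_top, expNegMul_of_ne_top 1 hy] at h
    exact absurd h.symm (Real.exp_ne_zero _)
  · rw [hy, expNegMul_top, expNegMul_of_ne_top 1 hx] at h
    exact absurd h (Real.exp_ne_zero _)
  · rw [expNegMul_of_ne_top 1 hx, expNegMul_of_ne_top 1 hy, Real.exp_eq_exp] at h
    exact (ENNReal.toReal_eq_toReal_iff' hx hy).1 (by linarith)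

/-! ### Laplace transforms and weak convergence on `[0, ∞]`. -/

/-- The continuous function `x ↦ e^{-x}` on `[0, ∞]`. -/
noncomputable def expNeg : C(ℝ≥0∞, ℝ) := ⟨expNegMul 1, continuous_expNegMul one_pos⟩

@[simp]
lemma expNeg_apply (x : ℝ≥0∞) : expNeg x = expNegMul 1 x := rfl

lemma topologicalClosure_adjoin_expNeg :
    (Algebra.adjoin ℝ {expNeg}).topologicalClosure = ⊤ := by
  refine ContinuousMap.subalgebra_topologicalClosure_eq_top_of_separatesPoints _ fun x y hxy ↦ ?_
  exact ⟨expNeg, ⟨expNeg, Algebra.subset_adjoin rfl, rfl⟩, expNegMul_one_injective.ne hxy⟩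

/-- Convergence of all Laplace transforms implies weak convergence on `[0, ∞]`. -/
theorem tendsto_of_tendsto_laplace {ι : Type*} {L : Filter ι} {μ : ι → ProbabilityMeasure ℝ≥0∞}
    {ν : ProbabilityMeasure ℝ≥0∞}
    (h : ∀ l : ℝ, 0 < l → Tendsto (fun i ↦ ∫ x, expNegMul l x ∂(μ i : Measure ℝ≥0∞)) L
      (𝓝 (∫ x, expNegMul l x ∂(ν : Measure ℝ≥0∞)))) :
    Tendsto μ L (𝓝 ν) := by
  have hint (f : C(ℝ≥0∞, ℝ)) (ρ : ProbabilityMeasure ℝ≥0∞) :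
      Integrable f (ρ : Measure ℝ≥0∞) :=
    (BoundedContinuousFunction.mkOfCompact f).integrable _
  have hpoly : ∀ f ∈ Algebra.adjoin ℝ {expNeg},
      Tendsto (fun i ↦ ∫ x, f x ∂(μ i : Measure ℝ≥0∞)) L (𝓝 (∫ x, f x ∂(ν : Measure ℝ≥0∞))) := by
    intro f hf
    rw [Algebra.adjoin_singleton_eq_range_aeval] at hf
    obtain ⟨p, rfl⟩ := hf
    induction p using Polynomial.induction_on' with
    | add p q hp hq =>
      have (ρ : ProbabilityMeasure ℝ≥0∞) := integral_add
        (hint (Polynomial.aeval expNeg p) ρ) (hint (Polynomial.aeval expNeg q) ρ)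
      simp only [AlgHom.toRingHom_eq_coe, RingHom.coe_coe, map_add, ContinuousMap.add_apply,
        this] at hp hq ⊢
      exact hp.add hq
    | monomial n c =>
      have (x : ℝ≥0∞) : Polynomial.aeval expNeg (Polynomial.monomial n c) x
          = c * expNegMul 1 x ^ n := by simp
      simp only [AlgHom.toRingHom_eq_coe, RingHom.coe_coe, this, integral_const_mul]
      refine Tendsto.const_mul c ?_
      -- The `n`-th power of `e^{-x}` is the Laplace kernel at `n`; `n = 0` is total mass, and is
      -- separate because `e^{-0·∞}` is `0` here.
      rcases eq_or_ne n 0 with rfl | hn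
      · simp [tendsto_const_nhds]
      · simpa [← expNegMul_natCast_mul n 1 hn] using h n (by positivity)
  rw [ProbabilityMeasure.tendsto_iff_forall_integral_tendsto]
  intro f
  rw [Metric.tendsto_nhds]
  intro ε hε
  have hf : f.toContinuousMap ∈ closure (Algebra.adjoin ℝ {expNeg} : Set C(ℝ≥0∞, ℝ)) := by
    have : f.toContinuousMap ∈ (Algebra.adjoin ℝ {expNeg}).topologicalClosure := by
      rw [topologicalClosure_adjoin_expNeg]; trivial
    exact this
  obtain ⟨g, hg, hfg⟩ := Metric.mem_closure_iff.1 hf (ε / 3) (by positivity)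
  have hclose (ρ : ProbabilityMeasure ℝ≥0∞) :
      dist (∫ x, f x ∂(ρ : Measure ℝ≥0∞)) (∫ x, g x ∂(ρ : Measure ℝ≥0∞)) ≤ ε / 3 := by
    rw [dist_eq_norm, ← integral_sub (f.integrable _) (hint g ρ)]
    refine (norm_integral_le_of_norm_le_const (C := ε / 3) (.of_forall fun x ↦ ?_)).trans (by simp)
    rw [← dist_eq_norm]
    exact (ContinuousMap.dist_apply_le_dist (f := f.toContinuousMap) (g := g) x).trans hfg.le
  filter_upwards [Metric.tendsto_nhds.1 (hpoly g hg) (ε / 3) (by positivity)] with i hi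
  have h1 := hclose (μ i)
  have h2 := hclose ν
  rw [dist_comm] at h2
  have := dist_triangle4 (∫ x, f x ∂(μ i : Measure ℝ≥0∞)) (∫ x, g x ∂(μ i : Measure ℝ≥0∞))
    (∫ x, g x ∂(ν : Measure ℝ≥0∞)) (∫ x, f x ∂(ν : Measure ℝ≥0∞))
  linarith

theorem eq_of_laplace_eq {μ ν : ProbabilityMeasure ℝ≥0∞}
    (h : ∀ l : ℝ, 0 < l →
      ∫ x, expNegMul l x ∂(μ : Measure ℝ≥0∞) = ∫ x, expNegMul l x ∂(ν : Measure ℝ≥0∞)) :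
    μ = ν :=
  tendsto_nhds_unique (f := fun _ : Unit ↦ μ) (l := ⊤) tendsto_const_nhds
    (tendsto_of_tendsto_laplace fun l hl ↦ by rw [h l hl]; exact tendsto_const_nhds)

/-! ### Truncated Lévy measures and jump laws. -/

namespace LevyTriplet

/-- Markov's inequality for `z ∧ 1` at level `γ ∧ 1`. -/
lemma levy_Ioi_lt_top (T : LevyTriplet) {γ : ℝ} (hγ : 0 < γ) : T.levy (Ioi γ) < ∞ := by
  have hc : ENNReal.ofReal (min γ 1) ≠ 0 := by simp [hγ]
  have hm : AEMeasurable (fun z : ℝ ↦ ENNReal.ofReal (min z 1)) T.levy := by fun_prop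
  refine (measure_mono fun z hz ↦ ?_).trans_lt
    ((meas_ge_le_lintegral_div hm hc ENNReal.ofReal_ne_top).trans_lt
      (ENNReal.div_lt_top T.lintegral_min_lt_top.ne hc))
  exact ENNReal.ofReal_le_ofReal (min_le_min_right 1 (le_of_lt hz))

lemma integrableOn_of_bound (T : LevyTriplet) {γ : ℝ} (hγ : 0 < γ) {h : ℝ → ℝ}
    (hh : Measurable h) (C : ℝ) (hC : ∀ x, |h x| ≤ C) : IntegrableOn h (Ioi γ) T.levy :=
  Measure.integrableOn_of_bounded (T.levy_Ioi_lt_top hγ).ne hh.aestronglyMeasurable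
    (M := C) (.of_forall hC)

lemma coe_tail (T : LevyTriplet) (γ : ℝ) : (T.tail γ : ℝ) = T.a + T.levy.real (Ioi γ) := rfl

lemma integral_jumpLaw (T : LevyTriplet) {γ : ℝ} (hγ : 0 < γ) {h : ℝ≥0∞ → ℝ}
    (hh : Measurable h) (C : ℝ) (hC : ∀ x, |h x| ≤ C) :
    ∫ y, h y ∂T.jumpLaw γ =
      (T.tail γ : ℝ)⁻¹ * (∫ s in Ioi γ, h (ENNReal.ofReal s) ∂T.levy + T.a * h ∞) := by
  have : IsFiniteMeasure (T.levy.restrict (Ioi γ)) := ⟨by simpa using T.levy_Ioi_lt_top hγ⟩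
  have hint (μ : Measure ℝ≥0∞) [IsFiniteMeasure μ] : Integrable h μ :=
    .of_bound hh.aestronglyMeasurable C (.of_forall hC)
  rw [jumpLaw, integral_smul_nnreal_measure, integral_add_measure (hint _) (hint _),
    integral_map ENNReal.measurable_ofReal.aemeasurable hh.aestronglyMeasurable,
    integral_smul_nnreal_measure, integral_dirac]
  simp [NNReal.smul_def, mul_add]

end LevyTriplet

/-! ### Laplace transform of the random walk. -/

variable {Ω : Type*} [MeasurableSpace Ω] {P : Measure Ω}

lemma IsPoissonProcess.hasLaw {r : ℝ≥0} {N : ℝ≥0 → Ω → ℕ} (hN : IsPoissonProcess r N P)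
    (t : ℝ≥0) : HasLaw (N t) (poissonMeasure (r * t)) P := by
  refine (hN.law 0 t).congr ?_
  filter_upwards [hN.zero] with ω hω
  simp [hω]

lemma integral_pow_poissonMeasure (r : ℝ≥0) (m : ℝ) :
    ∫ n, m ^ n ∂poissonMeasure r = Real.exp (-(r * (1 - m))) := by
  have h (n : ℕ) : (Real.exp (-r) * r ^ n / n.factorial) • m ^ n
      = Real.exp (-r) * ((r * m) ^ n / n.factorial) := by
    rw [smul_eq_mul, mul_pow]; ring
  simp_rw [integral_poissonMeasure, h]
  rw [tsum_mul_left, (NormedSpace.expSeries_div_hasSum_exp ((r : ℝ) * m)).tsum_eq,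
    ← Real.exp_eq_exp_ℝ, ← Real.exp_add]
  ring_nf

lemma measurable_sum_range : Measurable
    fun p : ℕ × (ℕ → ℝ≥0∞) ↦ ∑ j ∈ Finset.range p.1, p.2 j :=
  measurable_from_prod_countable_right fun n ↦
    (Finset.range n).measurable_fun_sum fun j _ ↦ measurable_pi_apply j

/-- The Laplace transform of a compound Poisson distribution. -/
lemma integral_expNegMul_compoundPoisson [IsProbabilityMeasure P] {r : ℝ≥0} {N : Ω → ℕ}
    (hN : HasLaw N (poissonMeasure r) P) {Y : ℕ → Ω → ℝ≥0∞} (hY : ∀ j, Measurable (Y j))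
    (hindep : iIndepFun Y P) (hNY : IndepFun N (fun ω j ↦ Y j ω) P) {l m : ℝ} (hl : 0 < l)
    (hm : ∀ j, ∫ ω, expNegMul l (Y j ω) ∂P = m) :
    ∫ ω, expNegMul l (∑ j ∈ Finset.range (N ω), Y j ω) ∂P = Real.exp (-(r * (1 - m))) := by
  have hY' : Measurable fun ω j ↦ Y j ω := measurable_pi_lambda _ hY
  have hmeas : Measurable fun p : ℕ × (ℕ → ℝ≥0∞) ↦
      expNegMul l (∑ j ∈ Finset.range p.1, p.2 j) :=
    (measurable_expNegMul hl).comp measurable_sum_range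
  have : IsProbabilityMeasure (P.map fun ω j ↦ Y j ω) :=
    Measure.isProbabilityMeasure_map hY'.aemeasurable
  rw [← integral_map (φ := fun ω ↦ (N ω, fun j ↦ Y j ω))
    (f := fun p : ℕ × (ℕ → ℝ≥0∞) ↦ expNegMul l (∑ j ∈ Finset.range p.1, p.2 j))
    (hN.aemeasurable.prodMk hY'.aemeasurable) hmeas.aestronglyMeasurable,
    (indepFun_iff_map_prod_eq_prod_map_map hN.aemeasurable hY'.aemeasurable).1 hNY, hN.map_eq,
    integral_prod, ← integral_pow_poissonMeasure]
  -- For a fixed number `n` of terms, independence of the jumps gives `m ^ n`.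
  · congr with n
    have hn : Measurable fun y : ℕ → ℝ≥0∞ ↦ expNegMul l (∑ j ∈ Finset.range n, y j) :=
      hmeas.comp measurable_prodMk_left
    rw [integral_map hY'.aemeasurable hn.aestronglyMeasurable]
    simp only [expNegMul_sum]
    have hind : iIndepFun (fun (j : Fin n) ω ↦ expNegMul l (Y j ω)) P :=
      (hindep.precomp Fin.val_injective).comp _ fun _ ↦ measurable_expNegMul hl
    have := hind.integral_fun_prod_eq_prod_integral fun j ↦
      ((measurable_expNegMul hl).comp (hY j)).aestronglyMeasurable
    simp only [Finset.prod_range]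
    simpa [hm] using this
  · refine .of_bound hmeas.aestronglyMeasurable 1 (.of_forall fun p ↦ ?_)
    rw [Real.norm_of_nonneg (expNegMul_nonneg _ _)]
    exact expNegMul_le_one hl _

lemma measurable_ctrw {b θ : ℝ≥0} {N : ℝ≥0 → Ω → ℕ} (hN : ∀ t, Measurable (N t))
    {Y : ℕ → Ω → ℝ≥0∞} (hY : ∀ j, Measurable (Y j)) (t : ℝ≥0) : Measurable (ctrw b θ N Y t) :=
  measurable_const.add <| measurable_sum_range.comp <|
    (hN _).prodMk (measurable_pi_lambda _ hY)

/-- The jumps above level `γ`: i.i.d. with law `T.jumpLaw γ` and independent of `N`. -/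
structure IsJumpSequence (T : LevyTriplet) (γ : ℝ) (N : ℝ≥0 → Ω → ℕ) (Y : ℕ → Ω → ℝ≥0∞)
    (P : Measure Ω) : Prop where
  measurable : ∀ j, Measurable (Y j)
  iIndepFun : iIndepFun Y P
  hasLaw : T.tail γ ≠ 0 → ∀ j, HasLaw (Y j) (T.jumpLaw γ) P
  indepFun : IndepFun (fun ω t ↦ N t ω) (fun ω j ↦ Y j ω) P

/-- The Laplace transform of the random walk with transformed jumps. -/
lemma integral_expNegMul_ctrw [IsProbabilityMeasure P] (T : LevyTriplet) {γ : ℝ} (hγ : 0 < γ)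
    {N : ℝ≥0 → Ω → ℕ} (hN : IsPoissonProcess 1 N P) {Y : ℕ → Ω → ℝ≥0∞}
    (hJ : IsJumpSequence T γ N Y P)
    {g : ℝ≥0∞ → ℝ≥0∞} (hg : Measurable g) (hg' : g ∞ = ∞) {l : ℝ} (hl : 0 < l) (t : ℝ≥0) :
    ∫ ω, expNegMul l (ctrw T.b (T.tail γ) N (fun j ω ↦ g (Y j ω)) t ω) ∂P =
      Real.exp (-(t * (T.a + T.b * l +
        ∫ s in Ioi γ, (1 - expNegMul l (g (ENNReal.ofReal s))) ∂T.levy))) := by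
  have hb : expNegMul l (T.b * t) = Real.exp (-(t * (T.b * l))) := by
    rw [expNegMul_of_ne_top l (by finiteness)]
    simp only [ENNReal.toReal_mul, ENNReal.coe_toReal]
    ring_nf
  simp only [ctrw, expNegMul_add, integral_const_mul, hb]
  by_cases hθ : T.tail γ = 0
  -- With `ν(γ) = 0` the jump law is unspecified, but the sum is a.s. empty and the exponent reduces
  -- to the drift.
  · have ha : T.a = 0 ∧ T.levy (Ioi γ) = 0 := by
      simpa [LevyTriplet.tail, ENNReal.toNNReal_eq_zero_iff, (T.levy_Ioi_lt_top hγ).ne] using hθ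
    have h1 : ∫ ω, expNegMul l (∑ j ∈ Finset.range (N (t * T.tail γ) ω), g (Y j ω)) ∂P = 1 := by
      rw [integral_congr_ae (g := fun _ ↦ (1 : ℝ)) ?_]
      · simp
      · filter_upwards [hN.zero] with ω hω
        simp [hθ, hω]
    rw [h1, Measure.restrict_eq_zero.2 ha.2, ha.1]
    simp
  · have hbound (x : ℝ≥0∞) : |expNegMul l (g x)| ≤ 1 := by
      rw [abs_of_nonneg (expNegMul_nonneg _ _)]
      exact expNegMul_le_one hl _
    have hm : Measurable fun x ↦ expNegMul l (g x) := (measurable_expNegMul hl).comp hg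
    have hm' : Measurable fun s ↦ expNegMul l (g (ENNReal.ofReal s)) :=
      hm.comp ENNReal.measurable_ofReal
    have hgt : Measurable fun (y : ℕ → ℝ≥0∞) j ↦ g (y j) := by fun_prop
    rw [integral_expNegMul_compoundPoisson (r := 1 * (t * T.tail γ)) (Y := fun j ω ↦ g (Y j ω))
      (m := ∫ y, expNegMul l (g y) ∂T.jumpLaw γ) (hN.hasLaw _)
      (fun j ↦ hg.comp (hJ.measurable j)) (hJ.iIndepFun.comp _ fun _ ↦ hg)
      (hJ.indepFun.comp (measurable_pi_apply (t * T.tail γ)) hgt) hl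
      fun j ↦ (hJ.hasLaw hθ j).integral_comp hm.aestronglyMeasurable, ← Real.exp_add,
      T.integral_jumpLaw hγ hm 1 hbound, integral_sub (T.integrableOn_of_bound hγ
        measurable_const 1 (by simp)) (T.integrableOn_of_bound hγ
        hm' 1 fun x ↦ hbound _)]
    have hθ' : (T.tail γ : ℝ) ≠ 0 := by exact_mod_cast hθ
    simp only [hg', expNegMul_top, integral_const, smul_eq_mul, mul_zero,
      add_zero, mul_one, measureReal_restrict_apply MeasurableSet.univ, univ_inter,
      NNReal.coe_mul, one_mul]
    congr 1
    -- The rate `ν(γ)` cancels the normalisation of the jump law; the atom at `∞` contributes only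
    -- `a`, since `e^{-∞} = 0`.
    have := T.coe_tail γ
    field_simp
    rw [this]
    ring

/-! ### Removing the truncation. -/

lemma LevyTriplet.ae_levy_pos (T : LevyTriplet) : ∀ᵐ s ∂T.levy, 0 < s := by
  rw [ae_iff]
  simpa [Iic] using T.levy_Iic_zero

lemma LevyTriplet.integrable_min (T : LevyTriplet) : Integrable (fun s ↦ min s 1) T.levy := by
  refine ⟨by fun_prop, ?_⟩
  rw [hasFiniteIntegral_iff_ofReal]
  · exact T.lintegral_min_lt_top
  · filter_upwards [T.ae_levy_pos] with s hs using le_min hs.le zero_le_one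

lemma one_sub_exp_neg_le {s : ℝ} (hs : 0 < s) (l : ℝ) :
    1 - Real.exp (-(s * l)) ≤ max l 1 * min s 1 := by
  rcases le_total s 1 with h | h
  · rw [min_eq_left h]
    have := Real.add_one_le_exp (-(s * l))
    have := mul_le_mul_of_nonneg_right (le_max_left l 1) hs.le
    linarith
  · rw [min_eq_right h]
    have := Real.exp_pos (-(s * l))
    linarith [le_max_right l 1]

lemma LevyTriplet.tendsto_setIntegral_Ioi (T : LevyTriplet) {l : ℝ} (hl : 0 < l) :
    Tendsto (fun γ ↦ T.a + T.b * l + ∫ s in Ioi γ, (1 - expNegMul l (ENNReal.ofReal s)) ∂T.levy)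
      (𝓝[>] 0) (𝓝 (T.bernstein l)) := by
  have hmeas : Measurable fun s ↦ 1 - expNegMul l (ENNReal.ofReal s) :=
    ((measurable_expNegMul hl).comp ENNReal.measurable_ofReal).const_sub 1
  refine Tendsto.const_add _ ?_
  simp only [← integral_indicator measurableSet_Ioi]
  refine tendsto_integral_filter_of_dominated_convergence (fun s ↦ max l 1 * min s 1)
    (.of_forall fun γ ↦ (hmeas.indicator measurableSet_Ioi).aestronglyMeasurable)
    (.of_forall fun γ ↦ ?_) (T.integrable_min.const_mul _) ?_
  · filter_upwards [T.ae_levy_pos] with s hs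
    refine (norm_indicator_le_norm_self _ _).trans ?_
    rw [Real.norm_of_nonneg (sub_nonneg.2 (expNegMul_le_one hl _)), expNegMul_ofReal l hs.le,
      mul_comm l]
    exact one_sub_exp_neg_le hs l
  · filter_upwards [T.ae_levy_pos] with s hs
    -- For fixed `s > 0` the truncated integrand is constant once `γ < s`.
    refine tendsto_const_nhds.congr' ?_
    filter_upwards [mem_nhdsWithin_of_mem_nhds (Iio_mem_nhds hs)] with γ hγ
    rw [indicator_of_mem (show s ∈ Ioi γ from hγ), expNegMul_ofReal l hs.le, mul_comm l]

/-! ### Consequences for random variables, and distribution functions at every point. -/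

section Laplace

variable {Ω' : Type*} [MeasurableSpace Ω'] {P' : Measure Ω'}

lemma map_eq_of_laplace_eq [IsProbabilityMeasure P] [IsProbabilityMeasure P'] {X : Ω → ℝ≥0∞}
    {X' : Ω' → ℝ≥0∞} (hX : AEMeasurable X P) (hX' : AEMeasurable X' P')
    (h : ∀ l : ℝ, 0 < l → ∫ ω, expNegMul l (X ω) ∂P = ∫ ω, expNegMul l (X' ω) ∂P') :
    P.map X = P'.map X' := by
  refine congrArg Subtype.val (eq_of_laplace_eq
    (μ := ⟨P.map X, Measure.isProbabilityMeasure_map hX⟩)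
    (ν := ⟨P'.map X', Measure.isProbabilityMeasure_map hX'⟩) fun l hl ↦ ?_)
  simp only [ProbabilityMeasure.coe_mk]
  rw [integral_map hX (measurable_expNegMul hl).aestronglyMeasurable,
    integral_map hX' (measurable_expNegMul hl).aestronglyMeasurable, h l hl]

lemma tendstoInDistribution_of_tendsto_laplace [IsProbabilityMeasure P] [IsProbabilityMeasure P']
    {ι : Type*} {L : Filter ι} {X : ι → Ω → ℝ≥0∞} {Z : Ω' → ℝ≥0∞}
    (hX : ∀ i, AEMeasurable (X i) P) (hZ : AEMeasurable Z P')
    (h : ∀ l : ℝ, 0 < l → Tendsto (fun i ↦ ∫ ω, expNegMul l (X i ω) ∂P) L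
      (𝓝 (∫ ω, expNegMul l (Z ω) ∂P'))) :
    TendstoInDistribution X L Z (fun _ ↦ P) P' where
  forall_aemeasurable := hX
  aemeasurable_limit := hZ
  tendsto := tendsto_of_tendsto_laplace fun l hl ↦ by
    simp only [ProbabilityMeasure.coe_mk]
    simp_rw [fun i ↦ integral_map (hX i) (measurable_expNegMul hl).aestronglyMeasurable,
      integral_map hZ (measurable_expNegMul hl).aestronglyMeasurable]
    exact h l hl

/-- For stochastically monotone sequences, convergence in distribution implies convergence of the
distribution functions at every point. -/
lemma tendsto_measure_le_of_stochasticallyMonotone [IsProbabilityMeasure P]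
    [IsProbabilityMeasure P'] {ι : Type*} {L : Filter ι} [L.NeBot] {X : ι → Ω → ℝ≥0∞}
    {Z : Ω' → ℝ≥0∞} (h : TendstoInDistribution X L Z (fun _ ↦ P) P')
    (hmono : ∀ i, ∀ᶠ j in L, ∀ c, P {ω | X j ω ≤ c} ≤ P {ω | X i ω ≤ c}) (c : ℝ≥0) :
    Tendsto (fun i ↦ P {ω | X i ω ≤ c}) L (𝓝 (P' {ω | Z ω ≤ c})) := by
  have hX := h.forall_aemeasurable
  have hZ := h.aemeasurable_limit
  refine tendsto_of_le_liminf_of_limsup_le (le_liminf_of_le (h := .of_forall fun i ↦ ?_)) ?_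
  -- The portmanteau bound on the open set `[0, c')`, with monotonicity, bounds the limit by every
  -- single `X i`; then `c' ↓ c`.
  · have hlt (c' : ℝ≥0∞) (hc' : c < c') : P' {ω | Z ω ≤ c} ≤ P {ω | X i ω ≤ c'} := by
      have hopen := ProbabilityMeasure.le_liminf_measure_open_of_tendsto h.tendsto
        (isOpen_Iio (a := c'))
      simp only [ProbabilityMeasure.coe_mk, Measure.map_apply_of_aemeasurable (hX _)
        measurableSet_Iio, Measure.map_apply_of_aemeasurable hZ measurableSet_Iio] at hopen
      refine (measure_mono fun ω hω ↦ ?_).trans (hopen.trans (liminf_le_of_frequently_le' ?_))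
      · exact lt_of_le_of_lt hω hc'
      · refine (hmono i).frequently.mono fun j hj ↦ (measure_mono fun ω hω ↦ ?_).trans (hj c')
        exact (mem_Iio.1 (mem_preimage.1 hω)).le
    have hlim := tendsto_measure_biInter_gt (μ := P) (s := fun c' ↦ {ω | X i ω ≤ c'})
      (a := (c : ℝ≥0∞)) (fun c' _ ↦ (hX i).nullMeasurable measurableSet_Iic)
      (fun _ _ _ hij ω hω ↦ le_trans hω hij) ⟨∞, by simp, by finiteness⟩
    have hinter : ⋂ c' > (c : ℝ≥0∞), {ω | X i ω ≤ c'} = {ω | X i ω ≤ c} := by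
      ext ω
      simpa using ⟨le_of_forall_gt_imp_ge_of_dense, fun h _ h' ↦ h.trans h'.le⟩
    rw [hinter] at hlim
    have : (𝓝[>] (c : ℝ≥0∞)).NeBot := nhdsGT_neBot_of_exists_gt ⟨∞, by simp⟩
    exact ge_of_tendsto hlim (eventually_mem_nhdsWithin.mono hlt)
  · have hclosed := ProbabilityMeasure.limsup_measure_closed_le_of_tendsto h.tendsto
      (isClosed_Iic (a := (c : ℝ≥0∞)))
    simp only [ProbabilityMeasure.coe_mk, Measure.map_apply_of_aemeasurable (hX _)
      measurableSet_Iic, Measure.map_apply_of_aemeasurable hZ measurableSet_Iic] at hclosed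
    exact hclosed

end Laplace

/-- Lowering the truncation level makes the random walk stochastically larger. -/
lemma measure_ctrw_le_mono [IsProbabilityMeasure P] (T : LevyTriplet) {γ γ' : ℝ} (hγ : 0 < γ')
    (hγγ' : γ' ≤ γ) {N : ℝ≥0 → Ω → ℕ} (hN : IsPoissonProcess 1 N P) {Y Y' : ℕ → Ω → ℝ≥0∞}
    (hY : IsJumpSequence T γ N Y P) (hY' : IsJumpSequence T γ' N Y' P) (t : ℝ≥0) (c : ℝ≥0∞) :
    P {ω | ctrw T.b (T.tail γ') N Y' t ω ≤ c} ≤ P {ω | ctrw T.b (T.tail γ) N Y t ω ≤ c} := by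
  have hγ0 := hγ.trans_le hγγ'
  -- Thinning: `g` erases jumps of size at most `γ` and keeps `∞`. The thinned walk has the Laplace
  -- transform of the walk of level `γ`, and is pointwise below the walk of level `γ'`.
  set g : ℝ≥0∞ → ℝ≥0∞ := (Ioi (ENNReal.ofReal γ)).indicator id with hg_def
  have hg : Measurable g := measurable_id.indicator measurableSet_Ioi
  have hg' : g ∞ = ∞ := indicator_of_mem (by simp) _
  have hgY (j) : Measurable fun ω ↦ g (Y' j ω) := hg.comp (hY'.measurable j)
  have hmeas := measurable_ctrw (b := T.b) (θ := T.tail γ) hN.measurable hY.measurable t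
  have hmeas' := measurable_ctrw (b := T.b) (θ := T.tail γ') hN.measurable hgY t
  have hmap := map_eq_of_laplace_eq (P := P) (P' := P) hmeas.aemeasurable hmeas'.aemeasurable
    fun l hl ↦ by
      have h := integral_expNegMul_ctrw T hγ0 hN hY measurable_id rfl hl t
      simp only [id] at h
      rw [h, integral_expNegMul_ctrw T hγ hN hY' hg hg' hl t]
      have hind : (fun s ↦ 1 - expNegMul l (g (ENNReal.ofReal s))) =
          (Ioi γ).indicator fun s ↦ 1 - expNegMul l (ENNReal.ofReal s) := by
        ext s
        by_cases hs : γ < s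
        · have : ENNReal.ofReal γ < ENNReal.ofReal s :=
            (ENNReal.ofReal_lt_ofReal_iff_of_nonneg hγ0.le).2 hs
          simp [hg_def, hs, this]
        · have : ¬ ENNReal.ofReal γ < ENNReal.ofReal s :=
            fun h ↦ hs ((ENNReal.ofReal_lt_ofReal_iff_of_nonneg hγ0.le).1 h)
          simp [hg_def, hs, this]
      rw [hind, setIntegral_indicator measurableSet_Ioi,
        inter_eq_right.2 (Ioi_subset_Ioi hγγ')]
  have heq := congrArg (fun μ ↦ μ (Iic c)) hmap
  simp only [Measure.map_apply hmeas measurableSet_Iic,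
    Measure.map_apply hmeas' measurableSet_Iic] at heq
  refine (measure_mono fun ω hω ↦ ?_).trans heq.ge
  refine mem_Iic.2 (le_trans ?_ (mem_ofPred.1 hω))
  unfold ctrw
  gcongr with j
  exact indicator_le_self _ _ _

/-! ### Hitting times of monotone paths. -/

section HittingTime

/-- Without right-continuity, `t < X u` is only sandwiched between `hittingTime X t < u` and
`hittingTime X t ≤ u`. -/
lemma lt_apply_of_hittingTime_lt {X : ℝ≥0 → ℝ≥0∞} (hX : Monotone X) {t u : ℝ≥0}
    (h : hittingTime X t < u) : t < X u := by
  simp only [hittingTime, iInf_lt_iff, ENNReal.coe_lt_coe] at h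
  obtain ⟨s, ⟨-, hs⟩, hsu⟩ := h
  exact hs.trans_le (hX hsu.le)

lemma hittingTime_le_of_lt_apply {X : ℝ≥0 → ℝ≥0∞} {t u : ℝ≥0} (hu : 0 < u) (h : t < X u) :
    hittingTime X t ≤ u :=
  iInf₂_le (f := fun (s : ℝ≥0) (_ : 0 < s ∧ (t : ℝ≥0∞) < X s) ↦ (s : ℝ≥0∞)) u ⟨hu, h⟩

/-- Applied to a countable `D`, this makes the hitting time a.e. measurable. -/
lemma hittingTime_eq_iInf_dense {X : ℝ≥0 → ℝ≥0∞} (hX : Monotone X) (t : ℝ≥0) {D : Set ℝ≥0}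
    (hD : Dense D) :
    hittingTime X t = ⨅ s ∈ D, if 0 < s ∧ (t : ℝ≥0∞) < X s then (s : ℝ≥0∞) else ∞ := by
  refine le_antisymm (le_iInf₂ fun s _ ↦ ?_) (le_of_forall_gt fun b hb ↦ ?_)
  · split_ifs with h
    · exact hittingTime_le_of_lt_apply h.1 h.2
    · exact le_top
  · simp only [hittingTime, iInf_lt_iff] at hb
    obtain ⟨s, ⟨hs0, hs⟩, hsb⟩ := hb
    obtain ⟨r, hsr, hrb⟩ := ENNReal.lt_iff_exists_nnreal_btwn.1 hsb
    obtain ⟨d, hd, hsd, hdr⟩ := hD.exists_between (ENNReal.coe_lt_coe.1 hsr)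
    refine (iInf₂_le d hd).trans_lt ?_
    rw [if_pos ⟨hs0.trans hsd, hs.trans_le (hX hsd.le)⟩]
    exact (ENNReal.coe_lt_coe.2 hdr).trans hrb

lemma aemeasurable_hittingTime {X : ℝ≥0 → Ω → ℝ≥0∞} (hX : ∀ s, Measurable (X s))
    (hmono : ∀ᵐ ω ∂P, Monotone fun s ↦ X s ω) (t : ℝ≥0) :
    AEMeasurable (fun ω ↦ hittingTime (fun s ↦ X s ω) t) P := by
  obtain ⟨D, hDc, hD⟩ := TopologicalSpace.exists_countable_dense ℝ≥0
  refine ⟨fun ω ↦ ⨅ s ∈ D, if 0 < s ∧ (t : ℝ≥0∞) < X s ω then (s : ℝ≥0∞) else ∞,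
    Measurable.biInf D hDc fun s _ ↦ Measurable.ite ?_ measurable_const measurable_const, ?_⟩
  · exact (MeasurableSet.const _).inter (measurableSet_lt measurable_const (hX s))
  · filter_upwards [hmono] with ω hω using hittingTime_eq_iInf_dense hω t hD

/-- The Laplace transform of a hitting time as an integral of tail probabilities. -/
lemma integral_expNegMul_hittingTime [IsProbabilityMeasure P] {X : ℝ≥0 → Ω → ℝ≥0∞}
    (hX : ∀ s, Measurable (X s)) (hmono : ∀ᵐ ω ∂P, Monotone fun s ↦ X s ω) (t : ℝ≥0)
    {l : ℝ} (hl : 0 < l) :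
    ∫ ω, expNegMul l (hittingTime (fun s ↦ X s ω) t) ∂P =
      ∫ s in Ioo (0 : ℝ) 1, P.real {ω | t < X (Real.toNNReal (-Real.log s / l)) ω} := by
  set H : Ω → ℝ≥0∞ := fun ω ↦ hittingTime (fun s ↦ X s ω) t
  have hH : AEMeasurable H P := aemeasurable_hittingTime hX hmono t
  have hint : Integrable (fun ω ↦ expNegMul l (H ω)) P := by
    refine .of_bound ((measurable_expNegMul hl).comp_aemeasurable hH).aestronglyMeasurable 1
      (.of_forall fun ω ↦ ?_)
    rw [Real.norm_of_nonneg (expNegMul_nonneg _ _)]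
    exact expNegMul_le_one hl _
  rw [hint.integral_eq_integral_meas_lt (.of_forall fun ω ↦ expNegMul_nonneg _ _),
    setIntegral_eq_of_subset_of_forall_sdiff_eq_zero measurableSet_Ioi Ioo_subset_Ioi_self]
  · refine integral_congr_ae ?_
    -- For almost every level `s` the events `s < e^{-lH}` and `s ≤ e^{-lH}` are equally likely,
    -- which closes the sandwich around `t < X u` at `u = -log s / l`.
    filter_upwards [meas_le_ae_eq_meas_lt P (volume.restrict (Ioo 0 1))
      (fun ω ↦ expNegMul l (H ω)), ae_restrict_mem measurableSet_Ioo] with s hs hs01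
    have hpos : 0 < Real.toNNReal (-Real.log s / l) :=
      Real.toNNReal_pos.2 (div_pos (neg_pos.2 (Real.log_neg hs01.1 hs01.2)) hl)
    have h1 : P {ω | s < expNegMul l (H ω)} ≤
        P {ω | t < X (Real.toNNReal (-Real.log s / l)) ω} := by
      refine measure_mono_ae ?_
      filter_upwards [hmono] with ω hω h
      exact lt_apply_of_hittingTime_lt hω ((lt_expNegMul_iff hl hs01.1 _).1 h)
    have h2 : P {ω | t < X (Real.toNNReal (-Real.log s / l)) ω} ≤
        P {ω | s ≤ expNegMul l (H ω)} := by
      refine measure_mono fun ω hω ↦ ?_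
      exact (le_expNegMul_iff hl hs01.1 hs01.2.le _).2
        (hittingTime_le_of_lt_apply (X := fun s ↦ X s ω) hpos hω)
    exact congrArg ENNReal.toReal (le_antisymm h1 (h2.trans hs.le))
  · intro s hs
    have : {ω | s < expNegMul l (H ω)} = ∅ := by
      refine eq_empty_of_forall_notMem fun ω hω ↦ hs.2 ⟨hs.1, ?_⟩
      exact lt_of_lt_of_le hω (expNegMul_le_one hl _)
    simp [this]

lemma aestronglyMeasurable_measureReal_lt [IsFiniteMeasure P] {X : ℝ≥0 → Ω → ℝ≥0∞}
    (hmono : ∀ᵐ ω ∂P, Monotone fun s ↦ X s ω) (t : ℝ≥0) {l : ℝ} (hl : 0 < l) :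
    AEStronglyMeasurable (fun s : ℝ ↦ P.real {ω | t < X (Real.toNNReal (-Real.log s / l)) ω})
      (volume.restrict (Ioo 0 1)) := by
  refine (aemeasurable_restrict_of_antitoneOn measurableSet_Ioo
    fun s hs s' hs' hss' ↦ ?_).aestronglyMeasurable
  refine ENNReal.toReal_mono (by finiteness) (measure_mono_ae ?_)
  filter_upwards [hmono] with ω hω h
  refine lt_of_lt_of_le h (hω (Real.toNNReal_le_toNNReal ?_))
  have := Real.log_le_log hs.1 hss'
  gcongr

lemma measureReal_lt_eq_one_sub [IsProbabilityMeasure P] {W : Ω → ℝ≥0∞} (hW : Measurable W)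
    (t : ℝ≥0∞) : P.real {ω | t < W ω} = 1 - (P {ω | W ω ≤ t}).toReal := by
  have : {ω | t < W ω} = {ω | W ω ≤ t}ᶜ := by ext; simp
  rw [this, probReal_compl_eq_one_sub (measurableSet_le hW measurable_const)]
  rfl

/-- Convergence of the one-dimensional distribution functions of monotone processes implies
convergence in distribution of their hitting times. -/
theorem tendstoInDistribution_hittingTime {Ω' : Type*} [MeasurableSpace Ω'] {P' : Measure Ω'}
    [IsProbabilityMeasure P] [IsProbabilityMeasure P'] {ι : Type*} {L : Filter ι}
    [L.IsCountablyGenerated] {X : ι → ℝ≥0 → Ω → ℝ≥0∞} {Z : ℝ≥0 → Ω' → ℝ≥0∞}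
    (hX : ∀ i s, Measurable (X i s)) (hZ : ∀ s, Measurable (Z s))
    (hXmono : ∀ i, ∀ᵐ ω ∂P, Monotone fun s ↦ X i s ω)
    (hZmono : ∀ᵐ ω ∂P', Monotone fun s ↦ Z s ω) (t : ℝ≥0)
    (h : ∀ s, Tendsto (fun i ↦ P {ω | X i s ω ≤ t}) L (𝓝 (P' {ω | Z s ω ≤ t}))) :
    TendstoInDistribution (fun i ω ↦ hittingTime (fun s ↦ X i s ω) t) L
      (fun ω ↦ hittingTime (fun s ↦ Z s ω) t) (fun _ ↦ P) P' := by
  refine tendstoInDistribution_of_tendsto_laplace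
    (fun i ↦ aemeasurable_hittingTime (hX i) (hXmono i) t)
    (aemeasurable_hittingTime hZ hZmono t) fun l hl ↦ ?_
  simp_rw [fun i ↦ integral_expNegMul_hittingTime (hX i) (hXmono i) t hl,
    integral_expNegMul_hittingTime hZ hZmono t hl]
  refine tendsto_integral_filter_of_dominated_convergence (fun _ ↦ 1)
    (.of_forall fun i ↦ aestronglyMeasurable_measureReal_lt (hXmono i) t hl)
    (.of_forall fun i ↦ .of_forall fun s ↦ ?_) (integrable_const 1) (.of_forall fun s ↦ ?_)
  · rw [Real.norm_of_nonneg measureReal_nonneg]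
    exact measureReal_le_one
  · simp only [measureReal_lt_eq_one_sub (hX _ _), measureReal_lt_eq_one_sub (hZ _)]
    exact ((ENNReal.tendsto_toReal (by finiteness)).comp (h _)).const_sub 1

end HittingTime

end SubordinatorCTRW

theorem mainTheorem4
    (T : SubordinatorCTRW.LevyTriplet)
    -- the subordinator with Laplace exponent `f`
    {Ω' : Type*} [MeasurableSpace Ω'] (P' : Measure Ω') [IsProbabilityMeasure P']
    (σ : ℝ≥0 → Ω' → ℝ≥0∞) (hσ : SubordinatorCTRW.IsSubordinator T σ P')
    -- the Poisson process of rate one and, for each `γ > 0`, the jumps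
    {Ω : Type*} [MeasurableSpace Ω] (P : Measure Ω) [IsProbabilityMeasure P]
    (N : ℝ≥0 → Ω → ℕ) (hN : SubordinatorCTRW.IsPoissonProcess 1 N P)
    (Y : Ioi (0 : ℝ) → ℕ → Ω → ℝ≥0∞)
    (hY_meas : ∀ γ j, Measurable (Y γ j))
    (hY_indep : ∀ γ, iIndepFun (Y γ) P)
    (hY_law : ∀ γ : Ioi (0 : ℝ), T.tail γ ≠ 0 → ∀ j, HasLaw (Y γ j) (T.jumpLaw γ) P)
    (hNY : ∀ γ, IndepFun (fun ω t ↦ N t ω) (fun ω j ↦ Y γ j ω) P) :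
    (∀ t : ℝ≥0, TendstoInDistribution
      (fun (γ : Ioi (0 : ℝ)) ω ↦ SubordinatorCTRW.ctrw T.b (T.tail γ) N (Y γ) t ω)
      (comap (fun γ : Ioi (0 : ℝ) ↦ (γ : ℝ)) (𝓝 0))
      (σ t) (fun _ ↦ P) P') ∧
    (∀ t : ℝ≥0, TendstoInDistribution
      (fun (γ : Ioi (0 : ℝ)) ω ↦ SubordinatorCTRW.hittingTime
        (fun s ↦ SubordinatorCTRW.ctrw T.b (T.tail γ) N (Y γ) s ω) t)
      (comap (fun γ : Ioi (0 : ℝ) ↦ (γ : ℝ)) (𝓝 0))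
      (fun ω ↦ SubordinatorCTRW.hittingTime (fun s ↦ σ s ω) t) (fun _ ↦ P) P') := by

  -- On positive `γ`, the neighbourhoods of `0` already encode `γ ↓ 0`.
  have hL : comap (fun γ : Ioi (0 : ℝ) ↦ (γ : ℝ)) (𝓝 0) =
      comap (fun γ : Ioi (0 : ℝ) ↦ (γ : ℝ)) (𝓝[>] 0) := by
    rw [nhdsWithin, comap_inf, comap_principal, Subtype.coe_preimage_self, principal_univ, inf_top_eq]
  have hbot : (comap (fun γ : Ioi (0 : ℝ) ↦ (γ : ℝ)) (𝓝 0)).NeBot := by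
    rw [hL]
    exact (inferInstance : (𝓝[>] (0 : ℝ)).NeBot).comap_of_range_mem (by
      rw [Subtype.range_coe]; exact self_mem_nhdsWithin)
  have hJ (γ : Ioi (0 : ℝ)) : SubordinatorCTRW.IsJumpSequence T γ N (Y γ) P :=
    ⟨hY_meas γ, hY_indep γ, hY_law γ, hNY γ⟩
  have hX (γ : Ioi (0 : ℝ)) (t : ℝ≥0) :
      Measurable (SubordinatorCTRW.ctrw T.b (T.tail γ) N (Y γ) t) :=
    SubordinatorCTRW.measurable_ctrw hN.measurable (hY_meas γ) t
  have hconv (t : ℝ≥0) : TendstoInDistribution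
      (fun (γ : Ioi (0 : ℝ)) ω ↦ SubordinatorCTRW.ctrw T.b (T.tail γ) N (Y γ) t ω)
      (comap (fun γ : Ioi (0 : ℝ) ↦ (γ : ℝ)) (𝓝 0)) (σ t) (fun _ ↦ P) P' := by
    refine SubordinatorCTRW.tendstoInDistribution_of_tendsto_laplace
      (fun γ ↦ (hX γ t).aemeasurable) (hσ.measurable t).aemeasurable fun l hl ↦ ?_
    rw [hσ.laplace t l hl, hL]
    have h (γ : Ioi (0 : ℝ)) := SubordinatorCTRW.integral_expNegMul_ctrw T γ.2 hN (hJ γ)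
      measurable_id rfl hl t
    simp only [id] at h
    simp only [h]
    exact (Real.continuous_exp.tendsto _).comp
      (((T.tendsto_setIntegral_Ioi hl).const_mul (t : ℝ)).neg.comp tendsto_comap)
  refine ⟨hconv, fun t ↦ SubordinatorCTRW.tendstoInDistribution_hittingTime hX hσ.measurable
    (fun γ ↦ ?_) hσ.mono t fun s ↦
      SubordinatorCTRW.tendsto_measure_le_of_stochasticallyMonotone (hconv s) (fun γ ↦ ?_) t⟩
  · filter_upwards [hN.mono] with ω hω s s' hss'
    simp only [SubordinatorCTRW.ctrw]
    gcongr
    exact hω (by gcongr)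
  · filter_upwards [preimage_mem_comap (Iio_mem_nhds γ.2)] with γ' hγ' c
    exact SubordinatorCTRW.measure_ctrw_le_mono T γ'.2 (le_of_lt hγ') hN (hJ γ) (hJ γ') s c
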